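/- For $n\in\mathbb{N}$ let $\mathbb{H}^n$ denote the real vector space of $n\times n$ complex Hermitian matrices (with its usual topology). A set $\mathcal{A}\subseteq\mathbb{H}^n$ is called \emph{simultaneously diagonalizable via congruence} (SDC) if there exists an invertible $P\in\mathbb{C}^{n\times n}$ such that $P^*AP$ is diagonal for all $A\in\mathcal{A}$. It is called \emph{almost simultaneously diagonalizable via congruence} (ASDC) if there exists a mapping $f:\mathcal{A}\times\mathbb{N}\to\mathbb{H}^n$ such that $\lim_{j\to\infty}f(A,j)=A$ for all $A\in\mathcal{A}$, and the set $\{f(A,j):A\in\mathcal{A}\}$ is SDC for every $j\in\mathbb{N}$. \textbf{Theorem.} Let $A,B,C\in\mathbb{H}^n$ and suppose that $A$ is invertible. Then $\{A,B,C\}$ is ASDC if and only if $A^{-1}B$ and $A^{-1}C$ commute and all (complex) eigenvalues of $A^{-1}B$ and of $A^{-1}C$ are real. -/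

import Mathlib

open Filter Topology Matrix

/-- The real vector space `ℍⁿ` of `n × n` complex Hermitian matrices. -/
abbrev Herm (n : ℕ) : Type := selfAdjoint (Matrix (Fin n) (Fin n) ℂ)

/-- `𝒜 ⊆ ℍⁿ` is simultaneously diagonalizable via congruence: there is one invertible complex
matrix `P` such that `P* A P` is diagonal for every `A ∈ 𝒜`. -/
def IsSDC {n : ℕ} (𝒜 : Set (Herm n)) : Prop :=
  ∃ P : Matrix (Fin n) (Fin n) ℂ, IsUnit P ∧
    ∀ A ∈ 𝒜, (Pᴴ * (A : Matrix (Fin n) (Fin n) ℂ) * P).IsDiag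

/-- `𝒜 ⊆ ℍⁿ` is almost simultaneously diagonalizable via congruence: there is a mapping
`f : 𝒜 × ℕ → ℍⁿ` with `f (A, j) → A` as `j → ∞` for every `A ∈ 𝒜`, such that
`{f (A, j) : A ∈ 𝒜}` is SDC for every `j`. -/
def IsASDC {n : ℕ} (𝒜 : Set (Herm n)) : Prop :=
  ∃ f : 𝒜 → ℕ → Herm n,
    (∀ A : 𝒜, Tendsto (f A) atTop (𝓝 (A : Herm n))) ∧
    ∀ j : ℕ, IsSDC (Set.range fun A : 𝒜 => f A j)

/-- Every (complex) eigenvalue of the complex matrix `M` is real. -/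
def HasRealEigenvalues {n : ℕ} (M : Matrix (Fin n) (Fin n) ℂ) : Prop :=
  ∀ μ : ℂ, Module.End.HasEigenvalue (Matrix.toLin' M) μ → μ.im = 0

/-!
Write `S = A⁻¹B` and `T = A⁻¹C`. Being ASDC means that `(A, B, C)` lies in the closure of the set
`sdcTriples` of triples `(R* a R, R* b R, R* c R)` with `R` invertible and `a, b, c` real diagonal
(`isASDC_iff_mem_closure`).

*Necessity.* On `sdcTriples` one has `B adj(A) C = C adj(A) B` and
`|Im μ| ^ n * |det A| ≤ |det (μ A - B)|` for all complex `μ`. Both conditions are closed, so they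
hold for `(A, B, C)`. As `det A ≠ 0`, the first says that `S` and `T` commute, and the second that
`S` has no non-real eigenvalue; exchanging `B` and `C` gives the same for `T`.

*Sufficiency.* The matrices `S` and `T` are commuting operators, self-adjoint for the indefinite
Hermitian form `A`, with real spectrum (`IsRealPair`). By induction on the size one shows
`(A, AS, AT) ∈ closure sdcTriples`.

* If a nontrivial `A`-self-adjoint idempotent commutes with `S` and `T`, the triple splits into two
  smaller ones (`IsRealPair.mem_closure_of_idempotent`). A real polynomial in `S` or in `T` is such
  an idempotent unless `S` and `T` each have a single eigenvalue
  (`isNilpotent_sub_or_exists_idempotent`). Subtracting real scalars, both may be taken nilpotent.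
* Replacing `T` by the combination `T + cS` of largest nilpotency index, say `T ^ d ≠ 0` and
  `(T + c'S) ^ (d + 1) = 0` for all real `c'`, gives `T ^ d S = 0`: this is, up to the factor
  `d + 1`, the linear coefficient of `(T + c'S) ^ (d + 1)`.
* Choose `x` with `x* A T ^ d x ≠ 0`. The form is nondegenerate on the span `W` of the `T ^ i x`,
  `i ≤ d`, and the `A`-orthogonal projection `π` onto `W` commutes with `T`.
* If `W` is a proper subspace, then for real `ε ≠ 0` the operator `S + επ` still commutes with `T`,
  is `A`-self-adjoint, and has no eigenvalues besides `0` and `ε`; a trace computation shows that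
  both occur. Hence the triple with `S + επ` in place of `S` splits, and `ε → 0` gives the claim.
* If `W` is the whole space, then in the basis `T ^ i x` all three forms are real Hankel matrices
  whose entries vanish below the antidiagonal. Such matrices are limits of `V* D V` with `V` the
  Vandermonde matrix of the nodes `εl` and `D` real diagonal, with the same `V` for all three
  (`hankel_mem_closure_sdcTriples`).
-/

variable {ι κ : Type} [Fintype ι] [DecidableEq ι] [Fintype κ] [DecidableEq κ]

/-! ### Simultaneously diagonal triples and their closure -/

/-- The matrix `R* diag(a) R` for a real vector `a`. The matrix `R` may be rectangular. -/
def diagCongr (R : Matrix κ ι ℂ) (a : κ → ℝ) : Matrix ι ι ℂ :=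
  Rᴴ * diagonal (fun k => (a k : ℂ)) * R

/-- The triples of Hermitian matrices that are simultaneously diagonal in some basis, written as
`(R* a R, R* b R, R* c R)` with one invertible `R` and real diagonal matrices `a`, `b`, `c`. -/
def sdcTriples (ι : Type) [Fintype ι] [DecidableEq ι] :
    Set (Matrix ι ι ℂ × Matrix ι ι ℂ × Matrix ι ι ℂ) :=
  {X | ∃ (R : Matrix ι ι ℂ) (a b c : ι → ℝ), IsUnit R ∧
    X = (diagCongr R a, diagCongr R b, diagCongr R c)}

theorem diagCongr_apply {μ : Type} (R : Matrix κ μ ℂ) (a : κ → ℝ) (i j : μ) :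
    diagCongr R a i j = ∑ k, (a k : ℂ) * (star (R k i) * R k j) := by
  rw [diagCongr, mul_apply]
  simp only [mul_diagonal, conjTranspose_apply]
  exact Finset.sum_congr rfl fun k _ => by ring

theorem card_eq_of_inverse {R : Matrix κ ι ℂ} {Q : Matrix ι κ ℂ} (h1 : R * Q = 1)
    (h2 : Q * R = 1) : Fintype.card κ = Fintype.card ι := by
  have := congrArg trace h1
  rw [trace_mul_comm, h2, trace_one, trace_one] at this
  exact_mod_cast this.symm

/-- An invertible `R` whose rows are indexed by another type also gives simultaneously diagonal
triples: the rows can be reindexed. -/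
theorem mem_sdcTriples_of_inverse {R : Matrix κ ι ℂ} {Q : Matrix ι κ ℂ} (h1 : R * Q = 1)
    (h2 : Q * R = 1) (a b c : κ → ℝ) :
    (diagCongr R a, diagCongr R b, diagCongr R c) ∈ sdcTriples ι := by
  let e : ι ≃ κ := Fintype.equivOfCardEq (card_eq_of_inverse h1 h2).symm
  refine ⟨R.submatrix e id, a ∘ e, b ∘ e, c ∘ e, ?_, ?_⟩
  · refine IsUnit.of_mul_eq_one (Q.submatrix id e) ?_
    rw [← submatrix_mul _ _ _ id _ Function.bijective_id, h1, submatrix_one_equiv]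
  · have key : ∀ a : κ → ℝ, diagCongr (R.submatrix e id) (a ∘ e) = diagCongr R a := by
      intro a
      ext i j
      rw [diagCongr_apply, diagCongr_apply]
      exact Equiv.sum_comp e fun k => (a k : ℂ) * (star (R k i) * R k j)
    rw [key, key, key]

theorem closure_sdcTriples_congr {L : Matrix κ ι ℂ} {K : Matrix ι κ ℂ} (h1 : L * K = 1)
    (h2 : K * L = 1) {A B C : Matrix κ κ ℂ} (h : (A, B, C) ∈ closure (sdcTriples κ)) :
    (Lᴴ * A * L, Lᴴ * B * L, Lᴴ * C * L) ∈ closure (sdcTriples ι) := by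
  let f : Matrix κ κ ℂ × Matrix κ κ ℂ × Matrix κ κ ℂ →
      Matrix ι ι ℂ × Matrix ι ι ℂ × Matrix ι ι ℂ :=
    fun X => (Lᴴ * X.1 * L, Lᴴ * X.2.1 * L, Lᴴ * X.2.2 * L)
  have hL : Continuous fun X : Matrix κ κ ℂ => Lᴴ * X * L :=
    (continuous_const.matrix_mul continuous_id).matrix_mul continuous_const
  have hf : Continuous f := (hL.comp continuous_fst).prodMk
    ((hL.comp (continuous_fst.comp continuous_snd)).prodMk
      (hL.comp (continuous_snd.comp continuous_snd)))
  have hm : Set.MapsTo f (sdcTriples κ) (sdcTriples ι) := by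
    rintro _ ⟨R, a, b, c, hR, rfl⟩
    obtain ⟨⟨R, R', hR1, hR2⟩, rfl⟩ := hR
    have key : ∀ a : κ → ℝ, Lᴴ * diagCongr R a * L = diagCongr (R * L) a := by
      intro a
      simp only [diagCongr, conjTranspose_mul, Matrix.mul_assoc]
    simp only [f, key]
    refine mem_sdcTriples_of_inverse (Q := K * R') ?_ ?_ a b c
    · rw [Matrix.mul_assoc, ← Matrix.mul_assoc L, h1, Matrix.one_mul, hR1]
    · rw [Matrix.mul_assoc, ← Matrix.mul_assoc R', hR2, Matrix.one_mul, h2]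
  exact (map_mem_closure hf h hm :)

/-- The closure is stable under real linear combinations of the three forms. These undo the
replacement of `S`, `T` by `S - s`, `T - t + c (S - s)`. -/
theorem closure_sdcTriples_mix {A B C : Matrix ι ι ℂ} (s t c : ℝ)
    (h : (A, B, C) ∈ closure (sdcTriples ι)) :
    (A, B + s • A, C + c • B + t • A) ∈ closure (sdcTriples ι) := by
  let f : Matrix ι ι ℂ × Matrix ι ι ℂ × Matrix ι ι ℂ →
      Matrix ι ι ℂ × Matrix ι ι ℂ × Matrix ι ι ℂ :=
    fun X => (X.1, X.2.1 + s • X.1, X.2.2 + c • X.2.1 + t • X.1)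
  have hf : Continuous f := by fun_prop
  have hm : Set.MapsTo f (sdcTriples ι) (sdcTriples ι) := by
    rintro _ ⟨R, a, b, d, hR, rfl⟩
    refine ⟨R, a, b + s • a, d + c • b + t • a, hR, ?_⟩
    have key : ∀ (r : ℝ) (a b : ι → ℝ),
        diagCongr R (a + r • b) = diagCongr R a + r • diagCongr R b := by
      intro r a b
      ext i j
      simp only [diagCongr_apply, Matrix.add_apply, Matrix.smul_apply, Finset.smul_sum,
        ← Finset.sum_add_distrib, Pi.add_apply, Pi.smul_apply, smul_eq_mul, Complex.real_smul]
      exact Finset.sum_congr rfl fun k _ => by push_cast; ring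
    simp only [f, key]
  exact (map_mem_closure hf h hm :)

theorem closure_sdcTriples_fromBlocks {A₁ B₁ C₁ : Matrix ι ι ℂ} {A₂ B₂ C₂ : Matrix κ κ ℂ}
    (h₁ : (A₁, B₁, C₁) ∈ closure (sdcTriples ι)) (h₂ : (A₂, B₂, C₂) ∈ closure (sdcTriples κ)) :
    (fromBlocks A₁ 0 0 A₂, fromBlocks B₁ 0 0 B₂, fromBlocks C₁ 0 0 C₂) ∈
      closure (sdcTriples (ι ⊕ κ)) := by
  let f : (Matrix ι ι ℂ × Matrix ι ι ℂ × Matrix ι ι ℂ) ×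
      (Matrix κ κ ℂ × Matrix κ κ ℂ × Matrix κ κ ℂ) →
      Matrix (ι ⊕ κ) (ι ⊕ κ) ℂ × Matrix (ι ⊕ κ) (ι ⊕ κ) ℂ × Matrix (ι ⊕ κ) (ι ⊕ κ) ℂ :=
    fun X => (fromBlocks X.1.1 0 0 X.2.1, fromBlocks X.1.2.1 0 0 X.2.2.1,
      fromBlocks X.1.2.2 0 0 X.2.2.2)
  have hf : Continuous f := by
    refine Continuous.prodMk ?_ (Continuous.prodMk ?_ ?_) <;>
    exact Continuous.matrix_fromBlocks (by fun_prop) continuous_const continuous_const (by fun_prop)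
  have h : ((A₁, B₁, C₁), (A₂, B₂, C₂)) ∈ closure (sdcTriples ι ×ˢ sdcTriples κ) := by
    rw [closure_prod_eq]
    exact ⟨h₁, h₂⟩
  have hm : Set.MapsTo f (sdcTriples ι ×ˢ sdcTriples κ) (sdcTriples (ι ⊕ κ)) := by
    rintro ⟨_, _⟩ ⟨⟨R, a, b, c, hR, rfl⟩, ⟨R', a', b', c', hR', rfl⟩⟩
    refine ⟨fromBlocks R 0 0 R', Sum.elim a a', Sum.elim b b', Sum.elim c c', ?_, ?_⟩
    · rw [isUnit_iff_isUnit_det] at *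
      rw [det_fromBlocks_zero₂₁]
      exact hR.mul hR'
    · have key : ∀ (a : ι → ℝ) (a' : κ → ℝ), fromBlocks (diagCongr R a) 0 0 (diagCongr R' a') =
          diagCongr (fromBlocks R 0 0 R') (Sum.elim a a') := by
        intro a a'
        have : (fun k => ((Sum.elim a a' k : ℝ) : ℂ)) =
            Sum.elim (fun k => (a k : ℂ)) (fun k => (a' k : ℂ)) := by
          ext (k | k) <;> rfl
        simp [diagCongr, this, ← fromBlocks_diagonal, fromBlocks_conjTranspose, fromBlocks_multiply]
      simp only [f, key]
  exact (map_mem_closure hf h hm :)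

/-! ### Hankel triples -/

/-- A real sequence vanishing from index `n` on is the limit, as `ε → 0`, of the moment sequences of
real weights on the `n` nodes `εl`. With `u i` the weights on the nodes `l` whose first `n` moments
are `δ i k`, the weights `∑ i, a i * ε ^ (-i) * u i` have `a k` as moment of index `k < n`, while
the moment of index `k ≥ n` has only terms of order `ε ^ (k - i)` with `i < n ≤ k`. -/
theorem exists_moments (n : ℕ) (a : ℕ → ℝ) (ha : ∀ k, n ≤ k → a k = 0) :
    ∃ w : ℝ → Fin n → ℝ, ∀ k : ℕ,
      Tendsto (fun ε : ℝ => ∑ l : Fin n, w ε l * (ε * (l : ℕ)) ^ k) (𝓝[≠] 0) (𝓝 (a k)) := by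
  let τ : Fin n → ℝ := fun l => ((l : ℕ) : ℝ)
  let V := vandermonde τ
  have hV : IsUnit V.det := by
    rw [isUnit_iff_ne_zero, det_vandermonde_ne_zero_iff]
    intro i j h
    exact Fin.ext (Nat.cast_injective h)
  have hVV : V⁻¹ * V = 1 := nonsing_inv_mul V hV
  let q : Fin n → ℕ → ℝ := fun i k => ∑ l, V⁻¹ i l * τ l ^ k
  refine ⟨fun ε l => ∑ i : Fin n, a i * (ε ^ (i : ℕ))⁻¹ * V⁻¹ i l, fun k => ?_⟩
  have h1 : ∀ ε : ℝ,
      ∑ l : Fin n, (∑ i : Fin n, a i * (ε ^ (i : ℕ))⁻¹ * V⁻¹ i l) * (ε * (l : ℕ)) ^ k =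
      ∑ i : Fin n, a i * (ε ^ k * (ε ^ (i : ℕ))⁻¹) * q i k := by
    intro ε
    simp only [q, Finset.sum_mul, Finset.mul_sum]
    rw [Finset.sum_comm]
    refine Finset.sum_congr rfl fun i _ => Finset.sum_congr rfl fun l _ => ?_
    simp only [τ, mul_pow]
    ring
  simp only [h1]
  rcases lt_or_ge k n with hk | hk
  · refine tendsto_const_nhds.congr' ?_
    filter_upwards [self_mem_nhdsWithin] with ε hε
    have hq : ∀ i : Fin n, q i k = if i = ⟨k, hk⟩ then 1 else 0 := by
      intro i
      have := congrFun (congrFun hVV i) ⟨k, hk⟩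
      rw [mul_apply, one_apply] at this
      simpa [V, vandermonde_apply, q] using this
    have hε' : ε ^ k ≠ 0 := pow_ne_zero _ hε
    simp [hq, hε']
  · rw [ha k hk, show 𝓝 (0 : ℝ) = 𝓝 (∑ _i : Fin n, (0 : ℝ)) by rw [Finset.sum_const_zero]]
    refine tendsto_finsetSum _ fun i _ => ?_
    have hlim : Tendsto (fun ε : ℝ => a i * ε ^ (k - i) * q i k) (𝓝[≠] 0) (𝓝 0) := by
      have : Continuous fun ε : ℝ => a i * ε ^ (k - i) * q i k := by fun_prop
      have h0 := (this.tendsto 0).mono_left (nhdsWithin_le_nhds (s := {0}ᶜ))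
      rwa [zero_pow (by omega), mul_zero, zero_mul] at h0
    refine hlim.congr' ?_
    filter_upwards [self_mem_nhdsWithin] with ε hε
    rw [pow_sub₀ _ hε (by omega)]

/-- Three real Hankel matrices with zero entries below the antidiagonal are simultaneously limits of
`V* D V` with a common Vandermonde matrix `V`. -/
theorem hankel_mem_closure_sdcTriples (n : ℕ) (a b c : ℕ → ℝ) (ha : ∀ k, n ≤ k → a k = 0)
    (hb : ∀ k, n ≤ k → b k = 0) (hc : ∀ k, n ≤ k → c k = 0) :
    ((of fun i j : Fin n => (a (i + j) : ℂ)), (of fun i j : Fin n => (b (i + j) : ℂ)),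
      (of fun i j : Fin n => (c (i + j) : ℂ))) ∈ closure (sdcTriples (Fin n)) := by
  let R : ℝ → Matrix (Fin n) (Fin n) ℂ := fun ε => vandermonde fun l => ((ε * (l : ℕ) : ℝ) : ℂ)
  have lim : ∀ (a : ℕ → ℝ), (∀ k, n ≤ k → a k = 0) → ∃ w : ℝ → Fin n → ℝ,
      Tendsto (fun ε => diagCongr (R ε) (w ε)) (𝓝[≠] 0)
        (𝓝 (of fun i j : Fin n => (a (i + j) : ℂ))) := by
    intro a ha
    obtain ⟨w, hw⟩ := exists_moments n a ha
    refine ⟨w, tendsto_pi_nhds.2 fun i => tendsto_pi_nhds.2 fun j => ?_⟩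
    have := (Complex.continuous_ofReal.tendsto _).comp (hw (i + j))
    refine this.congr fun ε => ?_
    rw [diagCongr_apply]
    simp only [Function.comp_apply, Complex.ofReal_sum]
    refine Finset.sum_congr rfl fun l _ => ?_
    simp only [R, vandermonde_apply, star_pow, RCLike.star_def, Complex.conj_ofReal]
    push_cast
    rw [pow_add]
  obtain ⟨u, hu⟩ := lim a ha
  obtain ⟨v, hv⟩ := lim b hb
  obtain ⟨w, hw⟩ := lim c hc
  refine mem_closure_of_tendsto (hu.prodMk_nhds (hv.prodMk_nhds hw)) ?_
  filter_upwards [self_mem_nhdsWithin] with ε hε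
  refine ⟨R ε, u ε, v ε, w ε, ?_, rfl⟩
  rw [isUnit_iff_isUnit_det, isUnit_iff_ne_zero, det_vandermonde_ne_zero_iff]
  intro i j h
  have h' := mul_left_cancel₀ hε (Complex.ofReal_injective h)
  exact Fin.ext (Nat.cast_injective h')

/-! ### Commuting pairs with real spectrum that are self-adjoint for a form -/

/-- `S` and `T` are commuting matrices with real eigenvalues, self-adjoint with respect to the
nondegenerate Hermitian form `A`. Self-adjointness is encoded by `A * S` and `A * T` being
Hermitian, and the eigenvalue condition by eigenvectors. -/
structure IsRealPair (A S T : Matrix ι ι ℂ) : Prop where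
  det_ne_zero : A.det ≠ 0
  herm : A.IsHermitian
  herm_left : (A * S).IsHermitian
  herm_right : (A * T).IsHermitian
  comm : S * T = T * S
  real_left : ∀ (μ : ℂ) (v : ι → ℂ), v ≠ 0 → S *ᵥ v = μ • v → μ.im = 0
  real_right : ∀ (μ : ℂ) (v : ι → ℂ), v ≠ 0 → T *ᵥ v = μ • v → μ.im = 0

/-- A basis adapted to the range and the kernel of a nontrivial idempotent, as an invertible matrix
`P` with inverse `Q`. -/
theorem exists_basis_of_idempotent {E : Matrix ι ι ℂ} (hE : E * E = E) (h0 : E ≠ 0)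
    (h1 : E ≠ 1) :
    ∃ (a b : ℕ) (P : Matrix ι (Fin a ⊕ Fin b) ℂ) (Q : Matrix (Fin a ⊕ Fin b) ι ℂ),
      a < Fintype.card ι ∧ b < Fintype.card ι ∧ P * Q = 1 ∧ Q * P = 1 ∧
      E * P = P * (fromBlocks 1 0 0 0 : Matrix (Fin a ⊕ Fin b) (Fin a ⊕ Fin b) ℂ) := by
  have hE' : IsIdempotentElem (toLin' E) := by
    rw [IsIdempotentElem, Module.End.mul_eq_comp, ← toLin'_mul, hE]
  have hc := LinearMap.IsIdempotentElem.isCompl hE'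
  set e := toLin' E with he
  have hrank := LinearMap.finrank_range_add_finrank_ker e
  rw [Module.finrank_pi] at hrank
  have hr : Module.finrank ℂ (LinearMap.range e) ≠ 0 := by
    rw [Ne, Submodule.finrank_eq_zero, LinearMap.range_eq_bot, he]
    simpa using h0
  have hk : Module.finrank ℂ (LinearMap.ker e) ≠ 0 := by
    rw [Ne, Submodule.finrank_eq_zero]
    intro h
    apply h1
    have hu : IsUnit e := (LinearMap.isUnit_iff_ker_eq_bot e).2 h
    have : e = 1 := hu.mul_left_cancel (by rw [mul_one]; exact hE')
    exact toLin'.injective (by rw [← he, this, toLin'_one]; rfl)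
  let b₁ := Module.finBasis ℂ (LinearMap.range e)
  let b₂ := Module.finBasis ℂ (LinearMap.ker e)
  let b := (b₁.prod b₂).map (Submodule.prodEquivOfIsCompl _ _ hc)
  refine ⟨_, _, (Pi.basisFun ℂ ι).toMatrix b, b.toMatrix (Pi.basisFun ℂ ι), by omega, by omega,
    Module.Basis.toMatrix_mul_toMatrix_flip _ _, Module.Basis.toMatrix_mul_toMatrix_flip _ _, ?_⟩
  have hl : ∀ i, E *ᵥ (b (Sum.inl i)) = b (Sum.inl i) := by
    intro i
    have : b (Sum.inl i) = (b₁ i : ι → ℂ) := by simp [b]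
    rw [this, ← toLin'_apply]
    exact (LinearMap.IsIdempotentElem.mem_range_iff hE').1 (b₁ i).2
  have hr : ∀ i, E *ᵥ (b (Sum.inr i)) = 0 := by
    intro i
    have : b (Sum.inr i) = (b₂ i : ι → ℂ) := by simp [b]
    rw [this, ← toLin'_apply]
    exact (b₂ i).2
  ext i (j | j)
  · have := congrFun (hl j) i
    simpa [mul_apply, Fintype.sum_sum_type, mulVec, dotProduct,
      Module.Basis.toMatrix_apply, one_apply] using this
  · have := congrFun (hr j) i
    simpa [mul_apply, Fintype.sum_sum_type, mulVec, dotProduct,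
      Module.Basis.toMatrix_apply] using this

theorem eq_fromBlocks_of_comm {κ : Type} [Fintype κ] {M : Matrix (ι ⊕ κ) (ι ⊕ κ) ℂ}
    (h : M * (fromBlocks 1 0 0 0 : Matrix (ι ⊕ κ) (ι ⊕ κ) ℂ) = fromBlocks 1 0 0 0 * M) :
    M = fromBlocks M.toBlocks₁₁ 0 0 M.toBlocks₂₂ := by
  rw [← fromBlocks_toBlocks M, fromBlocks_multiply, fromBlocks_multiply, fromBlocks_inj] at h
  conv_lhs => rw [← fromBlocks_toBlocks M]
  simp only [Matrix.mul_one, Matrix.mul_zero, Matrix.one_mul, Matrix.zero_mul, add_zero]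
    at h
  rw [← h.2.1, h.2.2.1]

theorem IsRealPair.congr {A S T : Matrix ι ι ℂ} (h : IsRealPair A S T) {P : Matrix ι κ ℂ}
    {Q : Matrix κ ι ℂ} (h1 : P * Q = 1) (h2 : Q * P = 1) :
    IsRealPair (Pᴴ * A * P) (Q * S * P) (Q * T * P) := by
  have hm : ∀ M N : Matrix ι ι ℂ, Q * M * P * (Q * N * P) = Q * (M * N) * P := by
    intro M N
    rw [Matrix.mul_assoc (Q * M), ← Matrix.mul_assoc P, ← Matrix.mul_assoc P, h1, Matrix.one_mul]
    simp only [Matrix.mul_assoc]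
  have hm' : ∀ M N : Matrix ι ι ℂ, Pᴴ * M * P * (Q * N * P) = Pᴴ * (M * N) * P := by
    intro M N
    rw [Matrix.mul_assoc (Pᴴ * M), ← Matrix.mul_assoc P, ← Matrix.mul_assoc P, h1, Matrix.one_mul]
    simp only [Matrix.mul_assoc]
  have hr : ∀ M : Matrix ι ι ℂ, (∀ (μ : ℂ) (v : ι → ℂ), v ≠ 0 → M *ᵥ v = μ • v → μ.im = 0) →
      ∀ (μ : ℂ) (v : κ → ℂ), v ≠ 0 → (Q * M * P) *ᵥ v = μ • v → μ.im = 0 := by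
    intro M hM μ v hv h
    refine hM μ (P *ᵥ v) (fun h0 => hv ?_) ?_
    · rw [← Matrix.one_mulVec v, ← h2, ← mulVec_mulVec, h0, mulVec_zero]
    · rw [← mulVec_smul, ← h, mulVec_mulVec, mulVec_mulVec, ← Matrix.mul_assoc, ← Matrix.mul_assoc,
        h1, Matrix.one_mul]
  refine ⟨?_, isHermitian_conjTranspose_mul_mul P h.herm, ?_, ?_, ?_, hr S h.real_left,
    hr T h.real_right⟩
  · intro h0
    obtain ⟨v, hv, hv0⟩ := exists_mulVec_eq_zero_iff.2 h0
    have : A *ᵥ (P *ᵥ v) = 0 := by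
      have := congrArg (fun w => Qᴴ *ᵥ w) hv0
      simp only [mulVec_mulVec, mulVec_zero] at this
      rw [← Matrix.mul_assoc, ← Matrix.mul_assoc, ← conjTranspose_mul, h1, conjTranspose_one,
        Matrix.one_mul] at this
      rw [mulVec_mulVec, this]
    refine h.det_ne_zero (exists_mulVec_eq_zero_iff.1 ⟨P *ᵥ v, fun h0 => hv ?_, this⟩)
    rw [← Matrix.one_mulVec v, ← h2, ← mulVec_mulVec, h0, mulVec_zero]
  · rw [hm']
    exact isHermitian_conjTranspose_mul_mul P h.herm_left
  · rw [hm']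
    exact isHermitian_conjTranspose_mul_mul P h.herm_right
  · rw [hm, hm, h.comm]

theorem IsRealPair.of_fromBlocks {A₁ S₁ T₁ : Matrix ι ι ℂ} {A₂ S₂ T₂ : Matrix κ κ ℂ}
    (h : IsRealPair (fromBlocks A₁ 0 0 A₂) (fromBlocks S₁ 0 0 S₂) (fromBlocks T₁ 0 0 T₂)) :
    IsRealPair A₁ S₁ T₁ ∧ IsRealPair A₂ S₂ T₂ := by
  obtain ⟨h1, h2, h3, h4, h5, h6, h7⟩ := h
  rw [det_fromBlocks_zero₂₁, mul_ne_zero_iff] at h1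
  rw [isHermitian_fromBlocks_iff] at h2
  simp only [fromBlocks_multiply, Matrix.mul_zero, Matrix.zero_mul, add_zero, zero_add,
    isHermitian_fromBlocks_iff, fromBlocks_inj] at h3 h4 h5
  have hl : ∀ {M : Matrix ι ι ℂ} {N : Matrix κ κ ℂ}, (∀ (μ : ℂ) (v : ι ⊕ κ → ℂ), v ≠ 0 →
      fromBlocks M 0 0 N *ᵥ v = μ • v → μ.im = 0) →
      ∀ (μ : ℂ) (v : ι → ℂ), v ≠ 0 → M *ᵥ v = μ • v → μ.im = 0 := by
    intro M N hM μ v hv h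
    refine hM μ (Sum.elim v 0) (fun h0 => hv ?_) ?_
    · ext i
      exact congrFun h0 (Sum.inl i)
    · rw [fromBlocks_mulVec]
      ext (i | i) <;> simp [h]
  have hr : ∀ {M : Matrix ι ι ℂ} {N : Matrix κ κ ℂ}, (∀ (μ : ℂ) (v : ι ⊕ κ → ℂ), v ≠ 0 →
      fromBlocks M 0 0 N *ᵥ v = μ • v → μ.im = 0) →
      ∀ (μ : ℂ) (v : κ → ℂ), v ≠ 0 → N *ᵥ v = μ • v → μ.im = 0 := by
    intro M N hM μ v hv h
    refine hM μ (Sum.elim 0 v) (fun h0 => hv ?_) ?_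
    · ext i
      exact congrFun h0 (Sum.inr i)
    · rw [fromBlocks_mulVec]
      ext (i | i) <;> simp [h]
  exact ⟨⟨h1.1, h2.1, h3.1, h4.1, h5.1, hl h6, hl h7⟩,
    ⟨h1.2, h2.2.2.2, h3.2.2.2, h4.2.2.2, h5.2.2.2, hr h6, hr h7⟩⟩

/-- The induction hypothesis: in every size below `n`, the triple `(A, AS, AT)` is a limit of
simultaneously diagonal triples. -/
def LimitBelow (n : ℕ) : Prop :=
  ∀ m < n, ∀ A S T : Matrix (Fin m) (Fin m) ℂ, IsRealPair A S T →
    (A, A * S, A * T) ∈ closure (sdcTriples (Fin m))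

/-- An idempotent commuting with `S` and `T` and self-adjoint for `A` makes all three forms block
diagonal in an adapted basis, so the claim follows from that for the two blocks. -/
theorem IsRealPair.mem_closure_of_idempotent (IH : LimitBelow (Fintype.card ι))
    {A S T E : Matrix ι ι ℂ} (h : IsRealPair A S T) (hE : E * E = E) (h0 : E ≠ 0) (h1 : E ≠ 1)
    (hES : E * S = S * E) (hET : E * T = T * E) (hAE : Eᴴ * A = A * E) :
    (A, A * S, A * T) ∈ closure (sdcTriples ι) := by
  obtain ⟨a, b, P, Q, ha, hb, hPQ, hQP, hP⟩ := exists_basis_of_idempotent hE h0 h1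
  have hQ : Q * E = (fromBlocks 1 0 0 0 : Matrix (Fin a ⊕ Fin b) (Fin a ⊕ Fin b) ℂ) * Q := by
    have := congrArg (fun M => Q * M * Q) hP
    simp only [Matrix.mul_assoc, hPQ, Matrix.mul_one] at this
    rwa [← Matrix.mul_assoc Q P, hQP, Matrix.one_mul] at this
  have hc := h.congr hPQ hQP
  have hA' : (Pᴴ * A * P) * (fromBlocks 1 0 0 0 : Matrix (Fin a ⊕ Fin b) (Fin a ⊕ Fin b) ℂ) =
      fromBlocks 1 0 0 0 * (Pᴴ * A * P) := by
    have hP' := congrArg conjTranspose hP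
    rw [conjTranspose_mul, conjTranspose_mul, fromBlocks_conjTranspose] at hP'
    simp only [conjTranspose_one, conjTranspose_zero] at hP'
    rw [← Matrix.mul_assoc, ← Matrix.mul_assoc, ← hP', Matrix.mul_assoc Pᴴ Eᴴ A, hAE,
      Matrix.mul_assoc _ P, ← hP]
    simp only [Matrix.mul_assoc]
  have hM' : ∀ M : Matrix ι ι ℂ, E * M = M * E →
      (Q * M * P) * (fromBlocks 1 0 0 0 : Matrix (Fin a ⊕ Fin b) (Fin a ⊕ Fin b) ℂ) =
        fromBlocks 1 0 0 0 * (Q * M * P) := by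
    intro M hM
    rw [← Matrix.mul_assoc, ← Matrix.mul_assoc, ← hQ, Matrix.mul_assoc Q E M, hM,
      Matrix.mul_assoc _ P, ← hP]
    simp only [Matrix.mul_assoc]
  have eA := eq_fromBlocks_of_comm hA'
  have eS := eq_fromBlocks_of_comm (hM' S hES)
  have eT := eq_fromBlocks_of_comm (hM' T hET)
  rw [eA, eS, eT] at hc
  obtain ⟨g₁, g₂⟩ := hc.of_fromBlocks
  have key := closure_sdcTriples_congr hQP hPQ
    (closure_sdcTriples_fromBlocks (IH a ha _ _ _ g₁) (IH b hb _ _ _ g₂))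
  have e2 : ∀ M : Matrix ι ι ℂ, Qᴴ * (Pᴴ * M * P) * Q = M := by
    intro M
    rw [Matrix.mul_assoc Pᴴ, ← Matrix.mul_assoc Qᴴ, ← conjTranspose_mul, hPQ, conjTranspose_one,
      Matrix.one_mul, Matrix.mul_assoc, hPQ, Matrix.mul_one]
  have e3 : ∀ M : Matrix ι ι ℂ, (Pᴴ * A * P) * (Q * M * P) = Pᴴ * (A * M) * P := by
    intro M
    rw [Matrix.mul_assoc (Pᴴ * A), ← Matrix.mul_assoc P, ← Matrix.mul_assoc P, hPQ, Matrix.one_mul]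
    simp only [Matrix.mul_assoc]
  have e4 : ∀ (M₁ N₁ : Matrix (Fin a) (Fin a) ℂ) (M₂ N₂ : Matrix (Fin b) (Fin b) ℂ),
      fromBlocks (M₁ * N₁) 0 0 (M₂ * N₂) = fromBlocks M₁ 0 0 M₂ * fromBlocks N₁ 0 0 N₂ := by
    intro M₁ N₁ M₂ N₂
    simp [fromBlocks_multiply]
  rw [e4, e4, ← eA, ← eS, ← eT, e3, e3, e2, e2, e2] at key
  exact key

/-! ### Spectral idempotents -/

theorem conjTranspose_pow_mul {A T : Matrix ι ι ℂ} (h : Tᴴ * A = A * T) (k : ℕ) :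
    (T ^ k)ᴴ * A = A * T ^ k := by
  induction k with
  | zero => simp
  | succ k ih =>
    rw [pow_succ', conjTranspose_mul, Matrix.mul_assoc, h, ← Matrix.mul_assoc, ih,
      Matrix.mul_assoc, ← pow_succ, pow_succ']

/-- Real polynomials in an `A`-self-adjoint matrix are `A`-self-adjoint. -/
theorem conjTranspose_aeval_mul {A S : Matrix ι ι ℂ} (hA : A.IsHermitian)
    (hS : (A * S).IsHermitian) (p : Polynomial ℝ) :
    (Polynomial.aeval S p)ᴴ * A = A * Polynomial.aeval S p := by
  have h1 : Sᴴ * A = A * S := by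
    have := hS.eq
    rwa [conjTranspose_mul, hA.eq] at this
  induction p using Polynomial.induction_on' with
  | add p q hp hq => rw [map_add, conjTranspose_add, add_mul, mul_add, hp, hq]
  | monomial k r =>
    rw [Polynomial.aeval_monomial, ← Algebra.smul_def, conjTranspose_smul, star_trivial,
      Matrix.smul_mul, Matrix.mul_smul]
    rw [conjTranspose_pow_mul h1]

theorem commute_aeval {S M : Matrix ι ι ℂ} (h : Commute S M) (p : Polynomial ℝ) :
    Commute (Polynomial.aeval S p) M := by
  induction p using Polynomial.induction_on' with
  | add p q hp hq => rw [map_add]; exact hp.add_left hq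
  | monomial k r =>
    rw [Polynomial.aeval_monomial, ← Algebra.smul_def]
    exact (h.pow_left k).smul_left r

/-- A matrix with real eigenvalues has just one eigenvalue, or some real polynomial in it is a
nontrivial idempotent, namely the projection onto a generalized eigenspace. -/
theorem isNilpotent_sub_or_exists_idempotent [Nonempty ι] (S : Matrix ι ι ℂ)
    (hS : ∀ (μ : ℂ) (v : ι → ℂ), v ≠ 0 → S *ᵥ v = μ • v → μ.im = 0) :
    (∃ μ : ℝ, IsNilpotent (S - μ • (1 : Matrix ι ι ℂ))) ∨
    ∃ p : Polynomial ℝ, Polynomial.aeval S p * Polynomial.aeval S p = Polynomial.aeval S p ∧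
      Polynomial.aeval S p ≠ 0 ∧ Polynomial.aeval S p ≠ 1 := by
  obtain ⟨μ', hμ⟩ := Module.End.exists_eigenvalue (toLin' S)
  obtain ⟨v, hv⟩ := hμ.exists_hasEigenvector
  have hv1 : S *ᵥ v = μ' • v := by
    have := hv.apply_eq_smul
    rwa [toLin'_apply] at this
  obtain ⟨μ, rfl⟩ : ∃ μ : ℝ, (μ : ℂ) = μ' := ⟨μ'.re, Complex.ext rfl (hS μ' v hv.2 hv1).symm⟩
  have hint : IsIntegral ℝ S := Algebra.IsIntegral.isIntegral S
  obtain ⟨q, hq, hnd⟩ := Polynomial.exists_eq_pow_rootMultiplicity_mul_and_not_dvd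
    (minpoly ℝ S) (minpoly.ne_zero hint) μ
  set k := (minpoly ℝ S).rootMultiplicity μ
  -- The exponent is `k + 1` rather than `k`, so that `(S - μ) ^ (k + 1)` kills `v` in any case.
  have hcop : IsCoprime ((Polynomial.X - Polynomial.C μ) ^ (k + 1)) q :=
    ((Polynomial.irreducible_X_sub_C μ).coprime_iff_not_dvd.2 hnd).pow_left
  obtain ⟨u, w, huw⟩ := hcop
  have hX : Polynomial.aeval S (Polynomial.X - Polynomial.C μ) = S - μ • (1 : Matrix ι ι ℂ) := by
    simp [Algebra.algebraMap_eq_smul_one]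
  have hann : Polynomial.aeval S ((Polynomial.X - Polynomial.C μ) ^ (k + 1) * q) = 0 := by
    have : (Polynomial.X - Polynomial.C μ) ^ (k + 1) * q =
        (Polynomial.X - Polynomial.C μ) * minpoly ℝ S := by
      conv_rhs => rw [hq]
      ring
    rw [this, map_mul, minpoly.aeval, mul_zero]
  by_cases h1 : Polynomial.aeval S (w * q) = 1
  · left
    refine ⟨μ, k + 1, ?_⟩
    rw [← hX, ← map_pow, ← mul_one (Polynomial.aeval S _), ← h1, ← map_mul]
    have : (Polynomial.X - Polynomial.C μ) ^ (k + 1) * (w * q) =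
        w * ((Polynomial.X - Polynomial.C μ) ^ (k + 1) * q) := by ring
    rw [this, map_mul, hann, mul_zero]
  · right
    refine ⟨w * q, ?_, ?_, h1⟩
    · have : w * q * (w * q) =
          w * q - u * w * ((Polynomial.X - Polynomial.C μ) ^ (k + 1) * q) := by
        linear_combination (w * q) * huw
      rw [← map_mul, this, map_sub, map_mul _ (u * w), hann, mul_zero, sub_zero]
    · intro h0
      have h2 := congrArg (Polynomial.aeval S) huw
      rw [map_add, h0, add_zero, map_mul, map_pow, hX, map_one, pow_succ, ← mul_assoc] at h2
      have h3 := congrArg (fun M => M *ᵥ v) h2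
      simp only [one_mulVec] at h3
      rw [← mulVec_mulVec, sub_mulVec, hv1, smul_mulVec, one_mulVec] at h3
      apply hv.2
      rw [← h3]
      simp

/-! ### Two facts used to choose a cyclic vector -/

theorem exists_star_dotProduct_mulVec_ne_zero {M : Matrix ι ι ℂ} (hM : M ≠ 0) :
    ∃ x : ι → ℂ, star x ⬝ᵥ (M *ᵥ x) ≠ 0 := by
  by_contra! h
  apply hM
  apply toEuclideanLin.injective
  rw [map_zero, ← inner_map_self_eq_zero]
  intro x
  rw [← inner_conj_symm, EuclideanSpace.inner_eq_star_dotProduct, dotProduct_comm]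
  have := h x.ofLp
  simp [this]

/-- The linear coefficient in `c` of `(T + c S) ^ (d + 1)` is `(d + 1) T ^ d S`, so it vanishes when
the power is zero for all real `c`. -/
theorem pow_mul_eq_zero_of_forall_add_smul_pow {S T : Matrix ι ι ℂ} (hc : S * T = T * S) (d : ℕ)
    (h : ∀ c : ℝ, (T + c • S) ^ (d + 1) = 0) : T ^ d * S = 0 := by
  have hcomm : Commute S T := hc
  ext i j
  let p : Polynomial ℂ := ∑ m ∈ Finset.range (d + 1 + 1),
    Polynomial.monomial m ((S ^ m * T ^ (d + 1 - m)) i j * ((d + 1).choose m : ℂ))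
  have hp : p = 0 := by
    refine Polynomial.eq_zero_of_infinite_isRoot p
      ((Set.infinite_range_of_injective Complex.ofReal_injective).mono ?_)
    rintro _ ⟨c, rfl⟩
    have h1 := congrFun (congrFun (h c) i) j
    have hcs : Commute (c • S) T := hcomm.smul_left c
    rw [add_comm, hcs.add_pow, Matrix.sum_apply] at h1
    simp only [Set.mem_ofPred_eq, Polynomial.IsRoot.def, p, Polynomial.eval_finsetSum,
      Polynomial.eval_monomial]
    refine Eq.trans (Finset.sum_congr rfl fun m _ => ?_) h1
    have e : (c • S) ^ m * T ^ (d + 1 - m) * ((d + 1).choose m : Matrix ι ι ℂ) =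
        (c ^ m) • ((d + 1).choose m • (S ^ m * T ^ (d + 1 - m))) := by
      rw [smul_pow, Matrix.smul_mul, Matrix.smul_mul, nsmul_eq_mul']
    rw [e, Matrix.smul_apply, Matrix.smul_apply, Complex.real_smul, nsmul_eq_mul]
    push_cast
    ring
  have h2 : p.coeff 1 = 0 := by rw [hp, Polynomial.coeff_zero]
  simp only [p, Polynomial.finsetSum_coeff, Polynomial.coeff_monomial] at h2
  rw [Finset.sum_ite_eq' , if_pos (by simp)] at h2
  simp only [pow_one, Nat.add_sub_cancel, Nat.choose_one_right, mul_eq_zero] at h2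
  rw [← (hcomm.pow_right d).eq, Matrix.zero_apply]
  exact h2.resolve_right (by exact_mod_cast d.succ_ne_zero)

/-! ### Cyclic subspaces of a nilpotent operator -/

/-- The matrix with columns `x, T x, …, T ^ (n - 1) x`. -/
def krylov (T : Matrix ι ι ℂ) (x : ι → ℂ) (n : ℕ) : Matrix ι (Fin n) ℂ :=
  of fun i k => (T ^ (k : ℕ) *ᵥ x) i

theorem mul_krylov_apply (M T : Matrix ι ι ℂ) (x : ι → ℂ) (n : ℕ) (i : ι) (j : Fin n) :
    (M * krylov T x n) i j = ((M * T ^ (j : ℕ)) *ᵥ x) i := by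
  rw [← mulVec_mulVec]
  rfl

/-- In the vectors `T ^ i x`, the form `A * N` has a Hankel matrix when `N` commutes with the
`A`-self-adjoint matrix `T`. -/
theorem krylov_gram_apply {A T N : Matrix ι ι ℂ} (h : Tᴴ * A = A * T) (hN : N * T = T * N)
    (x : ι → ℂ) (n : ℕ) (i j : Fin n) :
    ((krylov T x n)ᴴ * (A * N) * krylov T x n) i j =
      star x ⬝ᵥ ((A * (N * T ^ ((i : ℕ) + j))) *ᵥ x) := by
  have h1 : ((krylov T x n)ᴴ * (A * N) * krylov T x n) i j =
      star (T ^ (i : ℕ) *ᵥ x) ⬝ᵥ (((A * N) * T ^ (j : ℕ)) *ᵥ x) := by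
    rw [Matrix.mul_assoc, mul_apply]
    simp only [mul_krylov_apply]
    rfl
  rw [h1, star_mulVec, ← dotProduct_mulVec, mulVec_mulVec, ← Matrix.mul_assoc, ← Matrix.mul_assoc,
    conjTranspose_pow_mul h, Matrix.mul_assoc A, ← ((show Commute N T from hN).pow_right i).eq,
    Matrix.mul_assoc A, Matrix.mul_assoc N, ← pow_add]

theorem isUnit_of_antitriangular {n : ℕ} {G : Matrix (Fin n) (Fin n) ℂ}
    (h0 : ∀ i j : Fin n, n ≤ (i : ℕ) + j → G i j = 0)
    (h1 : ∀ i j : Fin n, (i : ℕ) + j + 1 = n → G i j ≠ 0) : IsUnit G := by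
  rw [← isUnit_submatrix_equiv (Equiv.refl _) Fin.revPerm, isUnit_iff_isUnit_det,
    isUnit_iff_ne_zero, det_of_isUpperTriangular]
  · refine Finset.prod_ne_zero_iff.2 fun i _ => h1 _ _ ?_
    simp [Fin.val_rev]
    omega
  · intro i j hij
    refine h0 _ _ ?_
    have : (j : ℕ) < i := hij
    simp [Fin.val_rev]
    omega

/-- Let `K` have columns `T ^ i x`, `i ≤ d`, with `T ^ (d + 1) = 0` and `x* A T ^ d x ≠ 0`. Its Gram
matrix `G = K* A K` is antitriangular, hence invertible, and `L = G⁻¹ K* A` is a left inverse of `K`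
for which `K * L` is the `A`-orthogonal projection onto the column space. The matrix `J` of `T` on
that space is the nilpotent shift, whose kernel is spanned by the last basis vector. -/
theorem exists_krylov_leftInverse {A T : Matrix ι ι ℂ} {d : ℕ} {x : ι → ℂ} (hA : A.IsHermitian)
    (hT : (A * T).IsHermitian) (hd : T ^ (d + 1) = 0) (hx : star x ⬝ᵥ ((A * T ^ d) *ᵥ x) ≠ 0) :
    ∃ (L : Matrix (Fin (d + 1)) ι ℂ) (J : Matrix (Fin (d + 1)) (Fin (d + 1)) ℂ),
      L * krylov T x (d + 1) = 1 ∧ (krylov T x (d + 1) * L)ᴴ * A = A * (krylov T x (d + 1) * L) ∧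
      T * krylov T x (d + 1) = krylov T x (d + 1) * J ∧ L * T = J * L ∧
      ∀ c : Fin (d + 1) → ℂ, J *ᵥ c = 0 → ∀ k : Fin (d + 1), (k : ℕ) < d → c k = 0 := by
  set K := krylov T x (d + 1) with hK
  have hTA : Tᴴ * A = A * T := by
    have := hT.eq
    rwa [conjTranspose_mul, hA.eq] at this
  set G := Kᴴ * A * K with hG
  have hGe : ∀ i j, G i j = star x ⬝ᵥ ((A * T ^ ((i : ℕ) + j)) *ᵥ x) := by
    intro i j
    have := krylov_gram_apply (N := 1) hTA (by simp) x (d + 1) i j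
    simpa using this
  have hz : ∀ k, d + 1 ≤ k → T ^ k = 0 := fun k hk => by
    rw [← Nat.sub_add_cancel hk, pow_add, hd, mul_zero]
  have hGu : IsUnit G := by
    refine isUnit_of_antitriangular (fun i j hij => ?_) (fun i j hij => ?_)
    · rw [hGe, hz _ hij, Matrix.mul_zero, zero_mulVec, dotProduct_zero]
    · rw [hGe, Nat.succ_injective hij]
      exact hx
  have hGd : IsUnit G.det := (isUnit_iff_isUnit_det G).1 hGu
  have hGh : G.IsHermitian := isHermitian_conjTranspose_mul_mul K hA
  let J : Matrix (Fin (d + 1)) (Fin (d + 1)) ℂ := of fun i j => if (i : ℕ) = j + 1 then 1 else 0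
  have hJ : T * K = K * J := by
    ext i j
    rw [mul_krylov_apply, ← pow_succ', mul_apply]
    simp only [J, of_apply, mul_ite, mul_one, mul_zero]
    rcases Nat.lt_or_ge (j + 1) (d + 1) with hj | hj
    · rw [Finset.sum_eq_single ⟨j + 1, hj⟩]
      · simp [K, krylov]
      · intro b _ hb
        rw [if_neg fun h => hb (Fin.ext h)]
      · simp
    · rw [hz _ hj, zero_mulVec, Pi.zero_apply, Finset.sum_eq_zero]
      intro b _
      rw [if_neg (by omega)]
  have hKJ : Kᴴ * A * T = Jᴴ * (Kᴴ * A) := by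
    rw [Matrix.mul_assoc, ← hTA, ← Matrix.mul_assoc, ← conjTranspose_mul, hJ, conjTranspose_mul,
      Matrix.mul_assoc]
  have hGJ : G * J = Jᴴ * G := by
    rw [hG, Matrix.mul_assoc, ← hJ, ← Matrix.mul_assoc, hKJ, Matrix.mul_assoc]
  have hGJ' : G⁻¹ * Jᴴ = J * G⁻¹ := by
    have : G⁻¹ * (G * J) * G⁻¹ = G⁻¹ * (Jᴴ * G) * G⁻¹ := by rw [hGJ]
    rw [← Matrix.mul_assoc, nonsing_inv_mul _ hGd, Matrix.one_mul, Matrix.mul_assoc,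
      Matrix.mul_assoc Jᴴ, mul_nonsing_inv _ hGd, Matrix.mul_one] at this
    exact this.symm
  refine ⟨G⁻¹ * (Kᴴ * A), J, ?_, ?_, hJ, ?_, ?_⟩
  · rw [Matrix.mul_assoc, ← hG, nonsing_inv_mul _ hGd]
  · rw [conjTranspose_mul, conjTranspose_mul, conjTranspose_mul, conjTranspose_conjTranspose, hA.eq,
      conjTranspose_nonsing_inv, hGh.eq]
    simp only [Matrix.mul_assoc]
  · rw [Matrix.mul_assoc, hKJ, ← Matrix.mul_assoc, hGJ', Matrix.mul_assoc]
  · intro c hc k hk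
    have := congrFun hc ⟨k + 1, by omega⟩
    simp only [mulVec, dotProduct, J, of_apply, Pi.zero_apply, ite_mul, one_mul, zero_mul] at this
    rw [Finset.sum_eq_single k] at this
    · simpa using this
    · intro b _ hb
      rw [if_neg fun h => hb (Fin.ext (by simpa using h.symm))]
    · simp

theorem krylov_mulVec_eq_smul {T : Matrix ι ι ℂ} {x : ι → ℂ} {d : ℕ} {c : Fin (d + 1) → ℂ}
    (hc : ∀ k : Fin (d + 1), (k : ℕ) < d → c k = 0) :
    krylov T x (d + 1) *ᵥ c = c (Fin.last d) • (T ^ d *ᵥ x) := by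
  ext i
  rw [mulVec, dotProduct, Finset.sum_eq_single (Fin.last d)]
  · simp [krylov, mul_comm]
  · intro b _ hb
    rw [hc b (Fin.val_lt_last hb), mul_zero]
  · simp

/-! ### The nilpotent case -/

/-- An eigenvector of a matrix commuting with a nilpotent `T` can be moved into the kernel of `T`, by
applying the last power of `T` that does not kill it. -/
theorem exists_ker_eigenvector {M T : Matrix ι ι ℂ} (hMT : M * T = T * M) (hT : IsNilpotent T)
    {μ : ℂ} {v : ι → ℂ} (hv : v ≠ 0) (h : M *ᵥ v = μ • v) :
    ∃ w : ι → ℂ, w ≠ 0 ∧ T *ᵥ w = 0 ∧ M *ᵥ w = μ • w := by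
  classical
  have hex : ∃ k, T ^ k *ᵥ v = 0 := by
    obtain ⟨n, hn⟩ := hT
    exact ⟨n, by rw [hn, zero_mulVec]⟩
  obtain ⟨k, hk⟩ : ∃ k, Nat.find hex = k + 1 := by
    refine Nat.exists_eq_succ_of_ne_zero fun h0 => hv ?_
    have := Nat.find_spec hex
    rwa [h0, pow_zero, one_mulVec] at this
  refine ⟨T ^ k *ᵥ v, Nat.find_min hex (by omega), ?_, ?_⟩
  · rw [mulVec_mulVec, ← pow_succ', ← hk]
    exact Nat.find_spec hex
  · rw [mulVec_mulVec, ((show Commute M T from hMT).pow_right k).eq, ← mulVec_mulVec, h,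
      mulVec_smul]

theorem eigenvalue_eq_zero_of_isNilpotent {T : Matrix ι ι ℂ} (hT : IsNilpotent T) {μ : ℂ}
    {v : ι → ℂ} (hv : v ≠ 0) (h : T *ᵥ v = μ • v) : μ = 0 := by
  obtain ⟨n, hn⟩ := hT
  have h1 : ∀ k, T ^ k *ᵥ v = μ ^ k • v := by
    intro k
    induction k with
    | zero => simp
    | succ k ih => rw [pow_succ, ← mulVec_mulVec, h, mulVec_smul, ih, smul_smul, pow_succ']
  have h2 := h1 n
  rw [hn, zero_mulVec] at h2
  exact eq_zero_of_pow_eq_zero ((smul_eq_zero.1 h2.symm).resolve_right hv)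

/-- The inductive step for nilpotent `S` and `T`, where `T` has been chosen so that `T ^ d S = 0`
for the last nonzero power `T ^ d`. -/
theorem IsRealPair.mem_closure_of_isNilpotent (IH : LimitBelow (Fintype.card ι))
    {A S T : Matrix ι ι ℂ} (h : IsRealPair A S T) (hS : IsNilpotent S) {d : ℕ}
    (hd : T ^ (d + 1) = 0) (hd0 : T ^ d ≠ 0) (hTS : T ^ d * S = 0) :
    (A, A * S, A * T) ∈ closure (sdcTriples ι) := by
  have hAu : IsUnit A := (isUnit_iff_isUnit_det A).2 (isUnit_iff_ne_zero.2 h.det_ne_zero)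
  have hTA : Tᴴ * A = A * T := by
    have := h.herm_right.eq
    rwa [conjTranspose_mul, h.herm.eq] at this
  obtain ⟨x, hx⟩ := exists_star_dotProduct_mulVec_ne_zero (M := A * T ^ d)
    fun h0 => hd0 (hAu.mul_left_cancel (by rw [h0, mul_zero]))
  obtain ⟨L, J, hLK, hπA, hTK, hLT, hJ⟩ := exists_krylov_leftInverse h.herm h.herm_right hd hx
  set K := krylov T x (d + 1) with hK
  by_cases hcard : d + 1 = Fintype.card ι
  -- The vectors `T ^ i x` span the whole space: all three forms are Hankel matrices.
  · have hKL : K * L = 1 := (mul_eq_one_comm_of_card_eq _ _ _ (by simpa using hcard)).1 hLK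
    have hz : ∀ k, d + 1 ≤ k → T ^ k = 0 := fun k hk => by
      rw [← Nat.sub_add_cancel hk, pow_add, hd, mul_zero]
    have key : ∀ N : Matrix ι ι ℂ, (A * N).IsHermitian → N * T = T * N →
        ∃ a : ℕ → ℝ, (∀ k, d + 1 ≤ k → a k = 0) ∧
          A * N = Lᴴ * (of fun i j : Fin (d + 1) => (a (i + j) : ℂ)) * L := by
      intro N hN hNT
      refine ⟨fun k => (star x ⬝ᵥ ((A * (N * T ^ k)) *ᵥ x)).re, fun k hk => ?_, ?_⟩
      · simp [hz k hk]
      · have e : (of fun i j : Fin (d + 1) =>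
            (((star x ⬝ᵥ ((A * (N * T ^ ((i : ℕ) + j))) *ᵥ x)).re : ℝ) : ℂ)) =
            Kᴴ * (A * N) * K := by
          ext i j
          rw [of_apply, krylov_gram_apply hTA hNT]
          have hh : (A * (N * T ^ ((i : ℕ) + j))).IsHermitian := by
            rw [IsHermitian, ← Matrix.mul_assoc, conjTranspose_mul, hN.eq, ← Matrix.mul_assoc,
              conjTranspose_pow_mul hTA, Matrix.mul_assoc, Matrix.mul_assoc,
              ((show Commute N T from hNT).pow_right _).eq]
          exact Complex.ext rfl (hh.im_star_dotProduct_mulVec_self x).symm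
        rw [e, ← Matrix.mul_assoc, ← Matrix.mul_assoc, ← conjTranspose_mul, hKL, conjTranspose_one,
          Matrix.one_mul, Matrix.mul_assoc, hKL, Matrix.mul_one]
    obtain ⟨a, ha, ea⟩ := key 1 (by simpa using h.herm) (by simp)
    obtain ⟨b, hb, eb⟩ := key S h.herm_left h.comm
    obtain ⟨c, hc, ec⟩ := key T h.herm_right rfl
    rw [mul_one] at ea
    rw [ea, ← ea, eb, ec, ea]
    exact closure_sdcTriples_congr hLK hKL (hankel_mem_closure_sdcTriples (d + 1) a b c ha hb hc)
  -- Otherwise `S` is perturbed by multiples of the projection `π` onto their span.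
  · set π := K * L with hπ
    have hππ : π * π = π := by
      rw [hπ, Matrix.mul_assoc, ← Matrix.mul_assoc L, hLK, Matrix.one_mul]
    have hπT : π * T = T * π := by
      rw [hπ, Matrix.mul_assoc, hLT, ← Matrix.mul_assoc, ← Matrix.mul_assoc, hTK]
    have hTn : IsNilpotent T := ⟨_, hd⟩
    set y := T ^ d *ᵥ x with hy
    have hSy : S *ᵥ y = 0 := by
      rw [hy, mulVec_mulVec, ((show Commute S T from h.comm).pow_right d).eq, hTS, zero_mulVec]
    have hy0 : y ≠ 0 := by
      intro h0
      apply hx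
      rw [← mulVec_mulVec, ← hy, h0, mulVec_zero, dotProduct_zero]
    have hKy : K *ᵥ Pi.single (Fin.last d) 1 = y := by
      rw [hK, krylov_mulVec_eq_smul (fun k hk => Pi.single_eq_of_ne
        (fun e => by rw [e, Fin.val_last] at hk; exact lt_irrefl _ hk) _), Pi.single_eq_same,
        one_smul]
    have hπy : π *ᵥ y = y := by
      rw [← hKy, mulVec_mulVec, hπ, Matrix.mul_assoc, hLK, Matrix.mul_one]
    have htr : π.trace = d + 1 := by
      rw [hπ, trace_mul_comm, hLK, trace_one, Fintype.card_fin]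
      push_cast
      rfl
    -- On the kernel of `T`, the projection `π` takes values in the line of `y`, which `S` kills.
    have hSπ : ∀ w, T *ᵥ w = 0 → S *ᵥ (π *ᵥ w) = 0 := by
      intro w hw
      rw [hπ, ← mulVec_mulVec, hK, krylov_mulVec_eq_smul (hJ (L *ᵥ w) ?_), ← hy, mulVec_smul, hSy,
        smul_zero]
      rw [mulVec_mulVec, ← hLT, ← mulVec_mulVec, hw, mulVec_zero]
    have hpair : ∀ ε : ℝ, IsRealPair A (S + ε • π) T := by
      intro ε
      have hcomm : (S + ε • π) * T = T * (S + ε • π) := by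
        rw [add_mul, mul_add, h.comm, Matrix.smul_mul, Matrix.mul_smul, hπT]
      refine ⟨h.det_ne_zero, h.herm, ?_, h.herm_right, hcomm, ?_, h.real_right⟩
      · rw [mul_add, Matrix.mul_smul]
        refine h.herm_left.add (IsHermitian.smul ?_ (IsSelfAdjoint.all ε))
        rw [IsHermitian, conjTranspose_mul, h.herm.eq, hπA]
      · intro μ v hv hμ
        obtain ⟨w, hw, hTw, hw'⟩ := exists_ker_eigenvector hcomm hTn hv hμ
        rw [add_mulVec, smul_mulVec] at hw'
        have hSw : S *ᵥ (S *ᵥ w) = μ • (S *ᵥ w) := by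
          have := congrArg (fun u => S *ᵥ u) hw'
          simpa only [mulVec_add, mulVec_smul, hSπ w hTw, smul_zero, add_zero] using this
        -- If `S w ≠ 0`, it is an eigenvector of the nilpotent `S` for `μ`; if `S w = 0`, then
        -- `ε π w = μ w` with `π` idempotent. So `μ` is `0` or `ε`.
        by_cases h0 : S *ᵥ w = 0
        · rw [h0, zero_add] at hw'
          have h1 : ε • (π *ᵥ w) = μ • (π *ᵥ w) := by
            have := congrArg (fun u => π *ᵥ u) hw'
            simpa only [mulVec_smul, mulVec_mulVec, hππ] using this
          by_cases h2 : π *ᵥ w = 0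
          · rw [h2, smul_zero] at hw'
            rw [(smul_eq_zero.1 hw'.symm).resolve_right hw, Complex.zero_im]
          · have h3 : ((ε : ℂ) - μ) • (π *ᵥ w) = 0 := by
              rw [sub_smul, ← h1, Complex.coe_smul, sub_self]
            rw [← sub_eq_zero.1 ((smul_eq_zero.1 h3).resolve_right h2), Complex.ofReal_im]
        · rw [eigenvalue_eq_zero_of_isNilpotent hS h0 hSw, Complex.zero_im]
    have hmem : ∀ ε : ℝ, ε ≠ 0 → (A, A * (S + ε • π), A * T) ∈ closure (sdcTriples ι) := by
      intro ε hε
      have hι : Nonempty ι := by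
        by_contra hne
        rw [not_nonempty_iff] at hne
        exact hy0 (Subsingleton.elim _ _)
      rcases isNilpotent_sub_or_exists_idempotent _ (hpair ε).real_left with
        ⟨μ, hμ⟩ | ⟨p, h1, h2, h3⟩
      -- A single eigenvalue would be `ε`, as `y` is an eigenvector for it, and comparing traces
      -- would give `ε (d + 1) = ε n`.
      · exfalso
        have e1 : (S + ε • π - μ • (1 : Matrix ι ι ℂ)) *ᵥ y = ((ε - μ : ℝ) : ℂ) • y := by
          rw [sub_mulVec, add_mulVec, smul_mulVec, smul_mulVec, hSy, hπy, one_mulVec, zero_add,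
            Complex.coe_smul, sub_smul]
        have e2 := eigenvalue_eq_zero_of_isNilpotent hμ hy0 e1
        rw [Complex.ofReal_eq_zero, sub_eq_zero] at e2
        subst e2
        have e3 := (isNilpotent_trace_of_isNilpotent hμ).eq_zero
        rw [trace_sub, trace_add, trace_smul, trace_smul, trace_one, htr,
          (isNilpotent_trace_of_isNilpotent hS).eq_zero, zero_add, ← smul_sub, smul_eq_zero] at e3
        apply hcard
        have e4 := sub_eq_zero.1 (e3.resolve_left hε)
        exact_mod_cast e4
      · exact (hpair ε).mem_closure_of_idempotent IH h1 h2 h3 (commute_aeval (Commute.refl _) p).eq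
          (commute_aeval (hpair ε).comm p).eq (conjTranspose_aeval_mul h.herm (hpair ε).herm_left p)
    have hlim : Tendsto (fun ε : ℝ => (A, A * (S + ε • π), A * T)) (𝓝[≠] 0)
        (𝓝 (A, A * S, A * T)) := by
      have hc : Continuous fun ε : ℝ => (A, A * (S + ε • π), A * T) := by fun_prop
      have := (hc.tendsto 0).mono_left (nhdsWithin_le_nhds (s := {0}ᶜ))
      rwa [zero_smul, add_zero] at this
    refine isClosed_closure.mem_of_tendsto hlim ?_
    filter_upwards [self_mem_nhdsWithin] with ε hε using hmem ε hε

/-! ### Approximation of commuting pairs -/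

/-- Among the real combinations `T + c S` of commuting nilpotent matrices there is one of largest
nilpotency index. -/
theorem exists_max_nilpotency_add_smul [Nonempty ι] {S T : Matrix ι ι ℂ} (hc : S * T = T * S)
    (hS : IsNilpotent S) (hT : IsNilpotent T) :
    ∃ (c : ℝ) (d : ℕ), (T + c • S) ^ d ≠ 0 ∧ ∀ c' : ℝ, (T + c' • S) ^ (d + 1) = 0 := by
  classical
  obtain ⟨m, hm⟩ := hS
  obtain ⟨n, hn⟩ := hT
  have hex : ∃ k, ∀ c : ℝ, (T + c • S) ^ k = 0 := by
    refine ⟨n + m, fun c => ?_⟩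
    have hcomm : Commute T (c • S) := (show Commute T S from hc.symm).smul_right c
    refine hcomm.add_pow_eq_zero_of_add_le_succ_of_pow_eq_zero hn ?_ (Nat.le_succ _)
    rw [smul_pow, hm, smul_zero]
  obtain ⟨d, hd⟩ : ∃ d, Nat.find hex = d + 1 := by
    refine Nat.exists_eq_succ_of_ne_zero fun h0 => ?_
    have := Nat.find_spec hex 0
    rw [h0, pow_zero] at this
    exact one_ne_zero this
  have h1 := Nat.find_min hex (m := d) (by omega)
  push Not at h1
  obtain ⟨c, hc⟩ := h1
  exact ⟨c, d, hc, hd ▸ Nat.find_spec hex⟩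

/-- Every pair of commuting `A`-self-adjoint matrices with real eigenvalues gives a limit of
simultaneously diagonal triples. -/
theorem IsRealPair.mem_closure (n : ℕ) (A S T : Matrix (Fin n) (Fin n) ℂ) (h : IsRealPair A S T) :
    (A, A * S, A * T) ∈ closure (sdcTriples (Fin n)) := by
  induction n using Nat.strong_induction_on with
  | _ n ih =>
  have IH : LimitBelow (Fintype.card (Fin n)) := by
    rw [Fintype.card_fin]
    exact ih
  rcases Nat.eq_zero_or_pos n with rfl | hn
  · exact subset_closure ⟨1, 0, 0, 0, isUnit_one, Subsingleton.elim _ _⟩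
  have hne : Nonempty (Fin n) := ⟨⟨0, hn⟩⟩
  rcases isNilpotent_sub_or_exists_idempotent S h.real_left with ⟨s, hs⟩ | ⟨p, h1, h2, h3⟩
  swap
  · exact h.mem_closure_of_idempotent IH h1 h2 h3 (commute_aeval (Commute.refl _) p).eq
      (commute_aeval h.comm p).eq (conjTranspose_aeval_mul h.herm h.herm_left p)
  rcases isNilpotent_sub_or_exists_idempotent T h.real_right with ⟨t, ht⟩ | ⟨p, h1, h2, h3⟩
  swap
  · exact h.mem_closure_of_idempotent IH h1 h2 h3 (commute_aeval h.comm.symm p).eq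
      (commute_aeval (Commute.refl _) p).eq (conjTranspose_aeval_mul h.herm h.herm_right p)
  set S' := S - s • (1 : Matrix (Fin n) (Fin n) ℂ) with hS'
  set T' := T - t • (1 : Matrix (Fin n) (Fin n) ℂ) with hT'
  have hcomm : Commute S' T' :=
    (Commute.sub_left (Commute.sub_right h.comm ((Commute.one_right _).smul_right t))
      ((Commute.one_left _).smul_left s))
  obtain ⟨c, d, hd0, hd⟩ := exists_max_nilpotency_add_smul hcomm.eq hs ht
  have hcomm' : Commute S' (T' + c • S') := hcomm.add_right ((Commute.refl S').smul_right c)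
  have hTS : (T' + c • S') ^ d * S' = 0 := by
    refine pow_mul_eq_zero_of_forall_add_smul_pow hcomm'.eq d fun c' => ?_
    rw [add_assoc, ← add_smul]
    exact hd _
  have hnil : ∀ {M : Matrix (Fin n) (Fin n) ℂ}, IsNilpotent M →
      ∀ (μ : ℂ) (v : Fin n → ℂ), v ≠ 0 → M *ᵥ v = μ • v → μ.im = 0 := by
    intro M hM μ v hv hμ
    rw [eigenvalue_eq_zero_of_isNilpotent hM hv hμ, Complex.zero_im]
  have hherm : ∀ {M : Matrix (Fin n) (Fin n) ℂ} (r : ℝ), (A * M).IsHermitian →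
      (A * (M - r • (1 : Matrix (Fin n) (Fin n) ℂ))).IsHermitian := by
    intro M r hM
    rw [mul_sub, Matrix.mul_smul, mul_one]
    exact hM.sub (h.herm.smul (IsSelfAdjoint.all r))
  have hpair : IsRealPair A S' (T' + c • S') := by
    refine ⟨h.det_ne_zero, h.herm, hherm s h.herm_left, ?_, hcomm'.eq, hnil hs, hnil ⟨d + 1, hd c⟩⟩
    rw [mul_add, Matrix.mul_smul]
    exact (hherm t h.herm_right).add ((hherm s h.herm_left).smul (IsSelfAdjoint.all c))
  have key := closure_sdcTriples_mix s t (-c)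
    (hpair.mem_closure_of_isNilpotent IH hs (hd c) hd0 hTS)
  convert key using 3
  · rw [hS', mul_sub, Matrix.mul_smul, mul_one, sub_add_cancel]
  · rw [mul_add, Matrix.mul_smul, neg_smul, add_neg_cancel_right, hT', mul_sub, Matrix.mul_smul,
      mul_one, sub_add_cancel]

/-! ### Closed conditions satisfied by simultaneously diagonal triples -/

/-- Commutation of `A⁻¹ B` and `A⁻¹ C` in a form that needs no inverse and is therefore a closed
condition. -/
theorem mul_adjugate_mul_comm_of_mem_sdcTriples {A B C : Matrix ι ι ℂ}
    (h : (A, B, C) ∈ sdcTriples ι) : B * A.adjugate * C = C * A.adjugate * B := by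
  obtain ⟨R, a, b, c, -, h⟩ := h
  simp only [Prod.mk.injEq] at h
  obtain ⟨rfl, rfl, rfl⟩ := h
  have key : ∀ D D' E : Matrix ι ι ℂ, Rᴴ * D * R * (R.adjugate * (E * (Rᴴ).adjugate)) *
      (Rᴴ * D' * R) = (R.det * (Rᴴ).det) • (Rᴴ * (D * E * D') * R) := by
    intro D D' E
    calc _ = Rᴴ * D * (R * R.adjugate) * E * ((Rᴴ).adjugate * Rᴴ) * D' * R := by
          simp only [Matrix.mul_assoc]
      _ = _ := by
          rw [mul_adjugate, adjugate_mul]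
          simp only [Matrix.mul_smul, Matrix.smul_mul, Matrix.mul_one, smul_smul, Matrix.mul_assoc]
          rw [mul_comm]
  simp only [diagCongr, adjugate_mul_distrib, adjugate_diagonal]
  rw [key, key]
  simp only [diagonal_mul_diagonal]
  congr 4
  ext i
  ring_nf

/-- On simultaneously diagonal triples `det (μ A - B)` is `|det R|²` times the product of the
`μ a i - b i`, and `|μ a i - b i| ≥ |Im μ| |a i|` for real `a i`, `b i`. -/
theorem abs_im_pow_mul_norm_det_le_of_mem_sdcTriples {A B C : Matrix ι ι ℂ}
    (h : (A, B, C) ∈ sdcTriples ι) (μ : ℂ) :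
    |μ.im| ^ Fintype.card ι * ‖A.det‖ ≤ ‖(μ • A - B).det‖ := by
  obtain ⟨R, a, b, c, -, h⟩ := h
  simp only [Prod.mk.injEq] at h
  obtain ⟨rfl, rfl, rfl⟩ := h
  have e : μ • diagCongr R a - diagCongr R b =
      Rᴴ * diagonal (fun i => μ * (a i : ℂ) - (b i : ℂ)) * R := by
    have : diagonal (fun i => μ * (a i : ℂ) - (b i : ℂ)) =
        μ • diagonal (fun i => (a i : ℂ)) - diagonal (fun i => (b i : ℂ)) := by
      ext i j
      by_cases hij : i = j
      · subst hij; simp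
      · simp [hij]
    rw [this, diagCongr, diagCongr, mul_sub, sub_mul, Matrix.mul_smul, Matrix.smul_mul]
  rw [e, diagCongr, det_mul, det_mul, det_mul, det_mul, det_diagonal, det_diagonal]
  simp only [norm_mul, norm_prod]
  have : |μ.im| ^ Fintype.card ι * ∏ i, ‖(a i : ℂ)‖ ≤ ∏ i, ‖μ * (a i : ℂ) - (b i : ℂ)‖ := by
    rw [← Finset.card_univ, ← Finset.prod_const, ← Finset.prod_mul_distrib]
    refine Finset.prod_le_prod (fun i _ => by positivity) fun i _ => ?_
    refine le_trans (le_of_eq ?_) (Complex.abs_im_le_norm _)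
    simp [abs_mul]
  calc _ = ‖(Rᴴ).det‖ * (|μ.im| ^ Fintype.card ι * ∏ i, ‖(a i : ℂ)‖) * ‖R.det‖ := by ring
    _ ≤ _ := by gcongr

theorem mul_adjugate_mul_comm_of_mem_closure {A B C : Matrix ι ι ℂ}
    (h : (A, B, C) ∈ closure (sdcTriples ι)) : B * A.adjugate * C = C * A.adjugate * B := by
  have hcl : IsClosed {X : Matrix ι ι ℂ × Matrix ι ι ℂ × Matrix ι ι ℂ |
      X.2.1 * X.1.adjugate * X.2.2 = X.2.2 * X.1.adjugate * X.2.1} := by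
    have hadj : Continuous fun X : Matrix ι ι ℂ × Matrix ι ι ℂ × Matrix ι ι ℂ => X.1.adjugate :=
      continuous_fst.matrix_adjugate
    have hB : Continuous fun X : Matrix ι ι ℂ × Matrix ι ι ℂ × Matrix ι ι ℂ => X.2.1 :=
      continuous_fst.comp continuous_snd
    have hC : Continuous fun X : Matrix ι ι ℂ × Matrix ι ι ℂ × Matrix ι ι ℂ => X.2.2 :=
      continuous_snd.comp continuous_snd
    exact isClosed_eq ((hB.matrix_mul hadj).matrix_mul hC) ((hC.matrix_mul hadj).matrix_mul hB)
  have hsub : sdcTriples ι ⊆ {X | X.2.1 * X.1.adjugate * X.2.2 = X.2.2 * X.1.adjugate * X.2.1} :=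
    fun ⟨_, _, _⟩ hX => mul_adjugate_mul_comm_of_mem_sdcTriples hX
  exact (closure_minimal hsub hcl h :)

theorem abs_im_pow_mul_norm_det_le_of_mem_closure {A B C : Matrix ι ι ℂ}
    (h : (A, B, C) ∈ closure (sdcTriples ι)) (μ : ℂ) :
    |μ.im| ^ Fintype.card ι * ‖A.det‖ ≤ ‖(μ • A - B).det‖ := by
  have hcl : IsClosed {X : Matrix ι ι ℂ × Matrix ι ι ℂ × Matrix ι ι ℂ |
      |μ.im| ^ Fintype.card ι * ‖X.1.det‖ ≤ ‖(μ • X.1 - X.2.1).det‖} := by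
    have h1 : Continuous fun X : Matrix ι ι ℂ × Matrix ι ι ℂ × Matrix ι ι ℂ => X.1.det :=
      continuous_fst.matrix_det
    have h2 : Continuous fun X : Matrix ι ι ℂ × Matrix ι ι ℂ × Matrix ι ι ℂ =>
        (μ • X.1 - X.2.1).det := Continuous.matrix_det (by fun_prop)
    exact isClosed_le (by fun_prop) (by fun_prop)
  exact closure_minimal (fun X hX => abs_im_pow_mul_norm_det_le_of_mem_sdcTriples hX μ) hcl h

theorem sdcTriples_swap {A B C : Matrix ι ι ℂ} (h : (A, B, C) ∈ closure (sdcTriples ι)) :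
    (A, C, B) ∈ closure (sdcTriples ι) := by
  have hf : Continuous fun X : Matrix ι ι ℂ × Matrix ι ι ℂ × Matrix ι ι ℂ =>
      (X.1, X.2.2, X.2.1) := by fun_prop
  have hm : Set.MapsTo (fun X : Matrix ι ι ℂ × Matrix ι ι ℂ × Matrix ι ι ℂ =>
      (X.1, X.2.2, X.2.1)) (sdcTriples ι) (sdcTriples ι) := by
    rintro _ ⟨R, a, b, c, hR, rfl⟩
    exact ⟨R, a, c, b, hR, rfl⟩
  exact (map_mem_closure hf h hm :)

theorem hasRealEigenvalues_of_mem_closure {n : ℕ} {A B C : Matrix (Fin n) (Fin n) ℂ}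
    (hA : IsUnit A) (h : (A, B, C) ∈ closure (sdcTriples (Fin n))) :
    HasRealEigenvalues (A⁻¹ * B) := by
  have hd : IsUnit A.det := (isUnit_iff_isUnit_det A).1 hA
  intro μ hμ
  obtain ⟨v, hv⟩ := hμ.exists_hasEigenvector
  have hv1 := hv.apply_eq_smul
  rw [toLin'_apply] at hv1
  have hker : (μ • A - B) *ᵥ v = 0 := by
    rw [sub_mulVec, smul_mulVec, ← mulVec_smul, ← hv1, mulVec_mulVec, ← Matrix.mul_assoc,
      mul_nonsing_inv _ hd, Matrix.one_mul, sub_self]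
  have hdet : (μ • A - B).det = 0 := exists_mulVec_eq_zero_iff.1 ⟨v, hv.2, hker⟩
  have := abs_im_pow_mul_norm_det_le_of_mem_closure h μ
  rw [hdet, norm_zero] at this
  by_contra him
  have h1 : 0 < |μ.im| ^ Fintype.card (Fin n) := pow_pos (abs_pos.2 him) _
  have h2 : 0 < ‖A.det‖ := norm_pos_iff.2 hd.ne_zero
  exact absurd this (not_le.2 (mul_pos h1 h2))

theorem commute_of_mem_closure {A B C : Matrix ι ι ℂ} (h : (A, B, C) ∈ closure (sdcTriples ι)) :
    Commute (A⁻¹ * B) (A⁻¹ * C) := by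
  have := mul_adjugate_mul_comm_of_mem_closure h
  rw [Matrix.mul_assoc, Matrix.mul_assoc] at this
  rw [Commute, SemiconjBy, inv_def]
  simp only [Matrix.smul_mul, Matrix.mul_smul, Matrix.mul_assoc, this]

/-! ### Almost simultaneous diagonalizability as membership in a closure -/

theorem exists_eq_diagCongr {P A : Matrix ι ι ℂ} (hP : IsUnit P) (hA : A.IsHermitian)
    (h : (Pᴴ * A * P).IsDiag) : ∃ a : ι → ℝ, A = diagCongr P⁻¹ a := by
  have hd : IsUnit P.det := (isUnit_iff_isUnit_det P).1 hP
  have hh : (Pᴴ * A * P).IsHermitian := isHermitian_conjTranspose_mul_mul P hA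
  refine ⟨fun i => ((Pᴴ * A * P) i i).re, ?_⟩
  have e : diagonal (fun i => (((Pᴴ * A * P) i i).re : ℂ)) = Pᴴ * A * P := by
    conv_rhs => rw [← h.diagonal_diag]
    congr 1
    ext i
    exact hh.coe_re_apply_self i
  rw [diagCongr, e]
  calc A = (P * P⁻¹)ᴴ * A * (P * P⁻¹) := by
        rw [mul_nonsing_inv _ hd, conjTranspose_one, Matrix.one_mul, Matrix.mul_one]
    _ = _ := by rw [conjTranspose_mul]; simp only [Matrix.mul_assoc]

theorem diagCongr_isHermitian (R : Matrix ι ι ℂ) (a : ι → ℝ) : (diagCongr R a).IsHermitian := by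
  refine isHermitian_conjTranspose_mul_mul R (isHermitian_diagonal_of_self_adjoint _ ?_)
  ext i
  simp

theorem isDiag_conjTranspose_inv_mul_diagCongr {R : Matrix ι ι ℂ} (hR : IsUnit R) (a : ι → ℝ) :
    ((R⁻¹)ᴴ * diagCongr R a * R⁻¹).IsDiag := by
  have hd : IsUnit R.det := (isUnit_iff_isUnit_det R).1 hR
  have : (R⁻¹)ᴴ * diagCongr R a * R⁻¹ = diagonal (fun i => (a i : ℂ)) := by
    calc _ = (R * R⁻¹)ᴴ * diagonal (fun i => (a i : ℂ)) * (R * R⁻¹) := by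
          rw [conjTranspose_mul, diagCongr]; simp only [Matrix.mul_assoc]
      _ = _ := by rw [mul_nonsing_inv _ hd, conjTranspose_one, Matrix.one_mul, Matrix.mul_one]
  rw [this]
  exact isDiag_diagonal _

/-- The set `{A, B, C}` is ASDC exactly when the triple `(A, B, C)` is a limit of simultaneously
diagonal triples. -/
theorem isASDC_iff_mem_closure {n : ℕ} (A B C : Herm n) :
    IsASDC ({A, B, C} : Set (Herm n)) ↔
      ((A : Matrix (Fin n) (Fin n) ℂ), (B : Matrix (Fin n) (Fin n) ℂ),
        (C : Matrix (Fin n) (Fin n) ℂ)) ∈ closure (sdcTriples (Fin n)) := by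
  classical
  have : FirstCountableTopology (Matrix (Fin n) (Fin n) ℂ) :=
    inferInstanceAs (FirstCountableTopology (Fin n → Fin n → ℂ))
  rw [mem_closure_iff_seq_limit]
  constructor
  · rintro ⟨f, hf, hs⟩
    have hlim : ∀ X : ({A, B, C} : Set (Herm n)), Tendsto
        (fun j => (f X j : Matrix (Fin n) (Fin n) ℂ)) atTop (𝓝 (X : Herm n)) :=
      fun X => (continuous_subtype_val.tendsto _).comp (hf X)
    refine ⟨fun j => (f ⟨A, by simp⟩ j, f ⟨B, by simp⟩ j, f ⟨C, by simp⟩ j), fun j => ?_,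
      (hlim _).prodMk_nhds ((hlim _).prodMk_nhds (hlim _))⟩
    obtain ⟨P, hP, hdiag⟩ := hs j
    have key := fun X => exists_eq_diagCongr hP (f X j).2 (hdiag _ ⟨X, rfl⟩)
    obtain ⟨a, ha⟩ := key ⟨A, by simp⟩
    obtain ⟨b, hb⟩ := key ⟨B, by simp⟩
    obtain ⟨c, hc⟩ := key ⟨C, by simp⟩
    exact ⟨P⁻¹, a, b, c, (isUnit_nonsing_inv_iff).2 hP, Prod.ext ha (Prod.ext hb hc)⟩
  · rintro ⟨X, hX, hlim⟩
    choose R a b c hR hXe using hX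
    let F : (j : ℕ) → (Fin n → ℝ) → Herm n := fun j a =>
      ⟨diagCongr (R j) a, diagCongr_isHermitian (R j) a⟩
    -- The map is defined on the set, so equal members of the triple must share one sequence.
    refine ⟨fun Y j => F j (if (Y : Herm n) = A then a j else if (Y : Herm n) = B then b j else c j),
      ?_, fun j => ⟨(R j)⁻¹, (isUnit_nonsing_inv_iff).2 (hR j), ?_⟩⟩
    · obtain rfl : X = fun j =>
          (diagCongr (R j) (a j), diagCongr (R j) (b j), diagCongr (R j) (c j)) :=
        funext hXe
      rintro ⟨Y, hY⟩
      rw [tendsto_subtype_rng]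
      by_cases h1 : Y = A
      · subst h1
        simpa [F, Function.comp_def] using (continuous_fst.tendsto _).comp hlim
      by_cases h2 : Y = B
      · subst h2
        simpa [F, h1, Function.comp_def] using
          ((continuous_fst.comp continuous_snd).tendsto _).comp hlim
      obtain rfl : Y = C := by simpa [h1, h2] using hY
      simpa [F, h1, h2, Function.comp_def] using
        ((continuous_snd.comp continuous_snd).tendsto _).comp hlim
    · rintro _ ⟨Y, rfl⟩
      exact isDiag_conjTranspose_inv_mul_diagCongr (hR j) _

theorem mainTheorem2 (n : ℕ) (A B C : Herm n)
    (hA : IsUnit (A : Matrix (Fin n) (Fin n) ℂ)) :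
    IsASDC ({A, B, C} : Set (Herm n)) ↔
      Commute ((A : Matrix (Fin n) (Fin n) ℂ)⁻¹ * (B : Matrix (Fin n) (Fin n) ℂ))
          ((A : Matrix (Fin n) (Fin n) ℂ)⁻¹ * (C : Matrix (Fin n) (Fin n) ℂ)) ∧
        HasRealEigenvalues ((A : Matrix (Fin n) (Fin n) ℂ)⁻¹ * (B : Matrix (Fin n) (Fin n) ℂ)) ∧
        HasRealEigenvalues ((A : Matrix (Fin n) (Fin n) ℂ)⁻¹ * (C : Matrix (Fin n) (Fin n) ℂ)) := by
  rw [isASDC_iff_mem_closure]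
  constructor
  · intro h
    exact ⟨commute_of_mem_closure h, hasRealEigenvalues_of_mem_closure hA h,
      hasRealEigenvalues_of_mem_closure hA (sdcTriples_swap h)⟩
  · rintro ⟨hcomm, hB, hC⟩
    have hd : IsUnit (A : Matrix (Fin n) (Fin n) ℂ).det := (isUnit_iff_isUnit_det _).1 hA
    have hmul : ∀ M : Matrix (Fin n) (Fin n) ℂ, (A : Matrix (Fin n) (Fin n) ℂ) *
        ((A : Matrix (Fin n) (Fin n) ℂ)⁻¹ * M) = M := by
      intro M
      rw [← Matrix.mul_assoc, mul_nonsing_inv _ hd, Matrix.one_mul]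
    have hreal : ∀ {M : Matrix (Fin n) (Fin n) ℂ}, HasRealEigenvalues M →
        ∀ (μ : ℂ) (v : Fin n → ℂ), v ≠ 0 → M *ᵥ v = μ • v → μ.im = 0 := by
      intro M hM μ v hv hμ
      exact hM μ (Module.End.hasEigenvalue_of_hasEigenvector (x := v)
        ⟨Module.End.mem_eigenspace_iff.2 (by rwa [toLin'_apply]), hv⟩)
    have := IsRealPair.mem_closure n (A : Matrix (Fin n) (Fin n) ℂ) _ _
      ⟨hd.ne_zero, A.2, by rw [hmul]; exact B.2, by rw [hmul]; exact C.2, hcomm.eq, hreal hB,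
        hreal hC⟩
    rwa [hmul, hmul] at this
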